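/- A Riesz operator on a complex Banach space $E$ is a bounded linear operator $T:E\to E$ such that, for every complex $\lambda\neq 0$: the map $\lambda-T$ is relatively open (open onto its range) and has closed range; $\dim\ker(\lambda-T)$ and $\operatorname{codim}(\lambda-T)(E)$ are finite and equal; the lengths of the chains $\ker((\lambda-T)^n)$ and $(\lambda-T)^n(E)$, $n\ge 0$ (the least $n$ from which on the chain is stationary), are finite and equal; and such that every non-zero point of the spectrum of $T$ is an eigenvalue and, if the set of non-zero spectral points is infinite, these points can be arranged in a sequence tending to $0$. **Theorem 2.1.** Let $B$ be a unital commutative semisimple complex Banach algebra whose maximal ideal space (the set of characters of $B$ with the weak-$*$ topology) is connected, and let $T:B\to B$ be a unital algebra endomorphism that is a Riesz operator. Then $\{f\in B: Tf=f\}$ is a one-dimensional Banach algebra, namely the closed subalgebra $\mathbb{C}\cdot 1$ of constants; that is, $Tf=f$ if and only if $f$ is a constant. Thus $1$ is an eigenvalue of $T$ of multiplicity $1$, both geometrically ($\dim\ker(1-T)=1$) and algebraically ($\dim\bigcup_{n}\ker((1-T)^n)=1$). -/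

import Mathlib

/-- A Riesz operator on a complex Banach space: a bounded linear operator `T` such that the
operators `lam - T` with `lam ≠ 0`, and the non-zero spectrum of `T`, satisfy the conditions below.
The spectrum is taken in the algebra of all linear maps; for a bounded operator on a Banach space
this is the usual spectrum, since a bounded bijection has a bounded inverse. -/
structure IsRieszOperator {E : Type*} [NormedAddCommGroup E] [NormedSpace ℂ E] [CompleteSpace E]
    (T : Module.End ℂ E) : Prop where
  /-- `T` is bounded. -/
  continuous : Continuous T
  /-- `lam - T` is relatively open, that is, open as a map onto its range. -/
  relativelyOpen : ∀ lam : ℂ, lam ≠ 0 →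
    IsOpenMap (Set.rangeFactorization (algebraMap ℂ (Module.End ℂ E) lam - T))
  /-- The range of `lam - T` is closed. -/
  isClosed_range : ∀ lam : ℂ, lam ≠ 0 →
    IsClosed (Set.range (algebraMap ℂ (Module.End ℂ E) lam - T))
  /-- The null space of `lam - T` is finite dimensional. -/
  finite_ker : ∀ lam : ℂ, lam ≠ 0 →
    FiniteDimensional ℂ (LinearMap.ker (algebraMap ℂ (Module.End ℂ E) lam - T))
  /-- The range of `lam - T` has finite codimension. -/
  finite_coker : ∀ lam : ℂ, lam ≠ 0 →
    FiniteDimensional ℂ (E ⧸ LinearMap.range (algebraMap ℂ (Module.End ℂ E) lam - T))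
  /-- The dimension of the null space equals the codimension of the range. -/
  finrank_ker_eq : ∀ lam : ℂ, lam ≠ 0 →
    Module.finrank ℂ (LinearMap.ker (algebraMap ℂ (Module.End ℂ E) lam - T)) =
      Module.finrank ℂ (E ⧸ LinearMap.range (algebraMap ℂ (Module.End ℂ E) lam - T))
  /-- The lengths of the null chain and of the image chain of `lam - T` (the least `n ≥ 0` from
  which on the kernels, respectively the ranges, of the powers are stationary) are finite
  and equal. -/
  chain_lengths : ∀ lam : ℂ, lam ≠ 0 → ∃ p : ℕ,
    IsLeast {n : ℕ | ∀ m, n ≤ m →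
      LinearMap.ker ((algebraMap ℂ (Module.End ℂ E) lam - T) ^ m) =
        LinearMap.ker ((algebraMap ℂ (Module.End ℂ E) lam - T) ^ n)} p ∧
    IsLeast {n : ℕ | ∀ m, n ≤ m →
      LinearMap.range ((algebraMap ℂ (Module.End ℂ E) lam - T) ^ m) =
        LinearMap.range ((algebraMap ℂ (Module.End ℂ E) lam - T) ^ n)} p
  /-- Every non-zero point of the spectrum is an eigenvalue. -/
  hasEigenvalue : ∀ lam ∈ spectrum ℂ T, lam ≠ 0 → Module.End.HasEigenvalue T lam
  /-- If the non-zero spectrum is infinite, its points form a sequence tending to `0`. -/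
  tendsto_zero : (spectrum ℂ T \ {0}).Infinite →
    ∃ u : ℕ → ℂ, Function.Injective u ∧ Set.range u = spectrum ℂ T \ {0} ∧
      Filter.Tendsto u Filter.atTop (nhds 0)

/-! The fixed points of `T` form a subalgebra inside the finite-dimensional space `ker (1 - T)`, so
each of them is integral over `ℂ`. Its Gelfand transform takes values among the roots of one
polynomial, hence is constant on the connected character space, and semisimplicity makes the element
itself constant. For the algebraic multiplicity, `(1 - T)² f = 0` now gives `T f = f + c`, so `T ^ n
f = f + n c`; the characters `φ ∘ T ^ n` are bounded on `f` uniformly in `n`, which forces `c = 0`.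
-/

open WeakDual in
/-- In a semisimple commutative Banach algebra, an element annihilated by all characters is `0`. -/
theorem eq_zero_of_forall_character_eq_zero {B : Type*} [NormedCommRing B] [NormedAlgebra ℂ B]
    [CompleteSpace B] (hss : Ring.jacobson B = ⊥) {g : B}
    (hg : ∀ φ : characterSpace ℂ B, φ g = 0) : g = 0 := by
  have hmem : g ∈ Ideal.jacobson (⊥ : Ideal B) := by
    refine Ideal.mem_jacobson_bot.2 fun y => ?_
    by_contra hy
    -- If `g * y + 1` is not a unit, some character kills it; but every character sends it to `1`.
    obtain ⟨φ, hφ⟩ := CharacterSpace.exists_apply_eq_zero hy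
    simp [hg φ] at hφ
  rwa [Ideal.jacobson_bot, hss, Ideal.mem_bot] at hmem

open WeakDual in
/-- If the maximal ideal space is preconnected, every integral element of a semisimple commutative
Banach algebra is a constant: its Gelfand transform is continuous with finite range. -/
theorem exists_eq_smul_one_of_isIntegral {B : Type*} [NormedCommRing B] [NormedAlgebra ℂ B]
    [CompleteSpace B] (hss : Ring.jacobson B = ⊥) [ConnectedSpace (characterSpace ℂ B)] {f : B}
    (hf : IsIntegral ℂ f) : ∃ c : ℂ, f = c • (1 : B) := by
  obtain ⟨p, hp, hpf⟩ := hf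
  have hpf' : Polynomial.aeval f p = 0 := hpf
  have hsub : Set.range (gelfandTransform ℂ B f) ⊆ (p.roots.toFinset : Set ℂ) := by
    rintro _ ⟨φ, rfl⟩
    have h := Polynomial.aeval_algHom_apply (CharacterSpace.toAlgHom φ) f p
    rw [hpf', map_zero] at h
    simpa [hp.ne_zero, Polynomial.IsRoot.def, Polynomial.coe_aeval_eq_eval] using h
  have hconst : (Set.range (gelfandTransform ℂ B f)).Subsingleton :=
    p.roots.toFinset.countable_toSet.isTotallyDisconnected _ hsub
      (isPreconnected_range (gelfandTransform ℂ B f).continuous)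
  obtain ⟨φ₀⟩ := (inferInstance : Nonempty (characterSpace ℂ B))
  refine ⟨φ₀ f, sub_eq_zero.1 (eq_zero_of_forall_character_eq_zero hss fun φ => ?_)⟩
  have h : φ f = φ₀ f := hconst ⟨φ, rfl⟩ ⟨φ₀, rfl⟩
  simp [map_sub, map_smul, h]

/-- An algebra endomorphism of a complex Banach algebra with a character cannot translate an element
by a nonzero constant, because the spectrum of the element is bounded. -/
theorem eq_zero_of_apply_eq_add_smul_one {B : Type*} [NormedRing B] [NormedAlgebra ℂ B]
    [CompleteSpace B] (φ : B →ₐ[ℂ] ℂ) (T : B →ₐ[ℂ] B) {f : B} {c : ℂ}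
    (hf : T f = f + c • (1 : B)) : c = 0 := by
  have hpow : ∀ n : ℕ, (T ^ n) f = f + (n * c) • (1 : B) := by
    intro n
    induction n with
    | zero => simp
    | succ n ih =>
      rw [pow_succ', AlgHom.mul_apply, ih, map_add, map_smul, map_one, hf, add_assoc, ← add_smul]
      push_cast
      ring_nf
  -- The left side is the value of `φ ∘ T ^ n` at `f`, a point of the spectrum of `f`. The factor
  -- `‖1‖` appears because the norm of `1` need not be `1`.
  have hbound : ∀ n : ℕ, ‖φ f + n * c‖ ≤ ‖f‖ * ‖(1 : B)‖ := by
    intro n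
    have h := spectrum.subset_closedBall_norm_mul f
      (AlgHom.apply_mem_spectrum (φ.comp (T ^ n)) f)
    rw [AlgHom.comp_apply, hpow n, mem_closedBall_zero_iff] at h
    simpa using h
  by_contra hc
  obtain ⟨n, hn⟩ := exists_nat_gt ((‖f‖ * ‖(1 : B)‖ + ‖φ f‖) / ‖c‖)
  rw [div_lt_iff₀ (norm_pos_iff.2 hc)] at hn
  have h : ‖(n : ℂ) * c‖ ≤ ‖φ f + n * c‖ + ‖φ f‖ := by
    simpa using norm_sub_le (φ f + n * c) (φ f)
  rw [norm_mul, Complex.norm_natCast] at h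
  linarith [hbound n]

/-- If `ker (T - μ)² = ker (T - μ)`, the maximal generalized eigenspace is the eigenspace. -/
theorem maxGenEigenspace_eq_eigenspace {R M : Type*} [CommRing R] [AddCommGroup M] [Module R M]
    {T : Module.End R M} {μ : R}
    (h : ∀ x, T x - μ • x ∈ T.eigenspace μ → x ∈ T.eigenspace μ) :
    T.maxGenEigenspace μ = T.eigenspace μ := by
  refine le_antisymm (fun x hx => ?_) Module.End.eigenspace_le_maxGenEigenspace
  obtain ⟨k, hk⟩ := (Module.End.mem_maxGenEigenspace _ _ _).1 hx
  clear hx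
  induction k generalizing x with
  | zero =>
    obtain rfl : x = 0 := by simpa using hk
    exact zero_mem _
  | succ k ih =>
    -- The `k`-th power of `T - μ` kills `T x - μ • x`, so induction puts that vector in the
    -- eigenspace.
    refine h x (ih _ ?_)
    rw [pow_succ, Module.End.mul_apply] at hk
    simpa using hk

/-- `Ring.jacobson B = ⊥` is semisimplicity of the Banach algebra `B`; its maximal ideal space is
the character space with the weak-* topology. An algebra homomorphism is unital here. -/
theorem theorem2p1 {B : Type*} [NormedCommRing B] [NormedAlgebra ℂ B] [CompleteSpace B]
    (hss : Ring.jacobson B = ⊥)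
    (hX : ConnectedSpace (WeakDual.characterSpace ℂ B))
    (T : B →ₐ[ℂ] B) (hT : IsRieszOperator T.toLinearMap) :
    -- the fixed space, a subalgebra of `B`, is a one-dimensional Banach algebra
    (IsClosed (AlgHom.equalizer T (AlgHom.id ℂ B) : Set B) ∧
      Module.finrank ℂ (AlgHom.equalizer T (AlgHom.id ℂ B)) = 1) ∧
    -- it consists exactly of the constants
    (∀ f : B, T f = f ↔ ∃ c : ℂ, f = c • (1 : B)) ∧
    -- `1` is an eigenvalue, of geometric and algebraic multiplicity one
    Module.End.HasEigenvalue T.toLinearMap 1 ∧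
    Module.finrank ℂ (Module.End.eigenspace T.toLinearMap 1) = 1 ∧
    Module.finrank ℂ (Module.End.maxGenEigenspace T.toLinearMap 1) = 1 := by
  have hfix : ∀ f : B, T f = f ↔ ∃ c : ℂ, f = c • (1 : B) := by
    refine fun f => ⟨fun hf => ?_, ?_⟩
    · have : FiniteDimensional ℂ (AlgHom.equalizer T (AlgHom.id ℂ B)) := by
        have := hT.finite_ker 1 one_ne_zero
        refine Submodule.finiteDimensional_of_le
          (S₁ := Subalgebra.toSubmodule (AlgHom.equalizer T (AlgHom.id ℂ B))) (fun g hg => ?_)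
          (S₂ := LinearMap.ker (algebraMap ℂ (Module.End ℂ B) 1 - T.toLinearMap))
        have hg' : T g = g := hg
        simp [hg']
      have hint := (Algebra.IsIntegral.isIntegral (R := ℂ)
        (⟨f, hf⟩ : AlgHom.equalizer T (AlgHom.id ℂ B))).map (Subalgebra.val _)
      exact exists_eq_smul_one_of_isIntegral hss hint
    · rintro ⟨c, rfl⟩
      simp
  obtain ⟨φ⟩ := hX.toNonempty
  have : Nontrivial B := (WeakDual.CharacterSpace.toAlgHom φ).toRingHom.domain_nontrivial
  have hbot : AlgHom.equalizer T (AlgHom.id ℂ B) = ⊥ := by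
    ext f
    simp only [AlgHom.mem_equalizer, AlgHom.id_apply, Algebra.mem_bot, Set.mem_range, hfix,
      Algebra.algebraMap_eq_smul_one, eq_comm]
  have hspan : Module.End.eigenspace T.toLinearMap 1 = ℂ ∙ (1 : B) := by
    ext f
    simp only [Module.End.mem_eigenspace_iff, AlgHom.toLinearMap_apply, one_smul, hfix,
      Submodule.mem_span_singleton, eq_comm]
  have hmax : Module.End.maxGenEigenspace T.toLinearMap 1 =
      Module.End.eigenspace T.toLinearMap 1 := by
    refine maxGenEigenspace_eq_eigenspace fun f hf => ?_
    rw [hspan, Submodule.mem_span_singleton] at hf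
    obtain ⟨c, hc⟩ := hf
    have hTf : T f = f + c • (1 : B) := by simp [hc]
    have hc0 := eq_zero_of_apply_eq_add_smul_one (WeakDual.CharacterSpace.toAlgHom φ) T hTf
    simpa [Module.End.mem_eigenspace_iff, hc0] using hTf
  refine ⟨⟨isClosed_eq hT.continuous continuous_id, ?_⟩, hfix, ?_, ?_, ?_⟩
  · rw [hbot, Subalgebra.finrank_bot]
  · rw [Module.End.hasEigenvalue_iff, hspan, Ne, Submodule.span_singleton_eq_bot]
    exact one_ne_zero
  · rw [hspan, finrank_span_singleton one_ne_zero]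
  · rw [hmax, hspan, finrank_span_singleton one_ne_zero]
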